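/- Let $N\ge 1$ and let $\Omega\subset\mathbb R^N$ be a non-empty bounded open set with Lipschitz boundary. Let $\Omega_1,\dots,\Omega_M$ be pairwise disjoint, connected, non-empty open subsets of $\Omega$ with Lipschitz boundary such that $\bigcup_{i=1}^M\overline{\Omega_i}=\overline\Omega$, and suppose that $$\mathcal H^{N-1}(\partial\Omega_i\cap\partial\Omega)>0\qquad\text{for all } i=1,\dots,M,$$ where $\mathcal H^{N-1}$ is the $(N-1)$-dimensional Hausdorff measure. Let $2\le p<\infty$. Then there is a constant $C_P>0$, depending only on $p,\Omega_1,\dots,\Omega_M$, such that the following holds for all $s_1,\dots,s_M\in(0,1)$. Put $s=\sum_{i=1}^M s_i\mathbf 1_{\Omega_i}$, $\bar s=\frac1{|\Omega|}\int_\Omega s\,dx$, $\mathcal C=\Omega\times(0,\infty)$ and $$w(x,y)=\mathrm G\,y^{1-2s(x)}\quad((x,y)\in\mathcal C),\qquad \mathrm G=2^{2\bar s-1}\frac{\Gamma(\bar s)}{\Gamma(1-\bar s)}.$$ Let $\|f\|_{L^p(\mathcal C,w)}=\left(\int_{\mathcal C}|f|^pw\,dX\right)^{1/p}$, let $W^{1,p}(\mathcal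 C,w)$ be the space of $u\in L^p(\mathcal C,w)$ with weak gradient $\nabla u$ such that $|\nabla u|\in L^p(\mathcal C,w)$, with the norm $(\|u\|_{L^p(\mathcal C,w)}^p+\|\nabla u\|_{L^p(\mathcal C,w)}^p)^{1/p}$, and let $\mathscr H^{1,p}_{0,L}(\mathcal C,w)$ be the closure in $W^{1,p}(\mathcal C,w)$ of the set of those $\varphi\in C^\infty(\overline{\mathcal C})\cap W^{1,p}(\mathcal C,w)$ with $\mathrm{supp}(\varphi)\cap(\partial\Omega\times[0,\infty))=\emptyset$. Then $$\|u\|_{L^p(\mathcal C,w)}\le C_P\,\|\nabla u\|_{L^p(\mathcal C,w)}\qquad\text{for all } u\in\mathscr H^{1,p}_{0,L}(\mathcal C,w).$$ -/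

import Mathlib

open MeasureTheory Set
open scoped ENNReal ContDiff

noncomputable section

namespace VarFrac

/-- The space `ℝᴺ` with its Euclidean norm. -/
abbrev Base (N : ℕ) : Type := EuclideanSpace ℝ (Fin N)

/-- The space `ℝᴺ⁺¹` of points `X = (x, y)`; its measure is the product Lebesgue measure. -/
abbrev Ext (N : ℕ) : Type := Base N × ℝ

/-- Vectors of `ℝᴺ⁺¹` with the Euclidean inner product; gradients take values here. -/
abbrev ExtVec (N : ℕ) : Type := WithLp 2 (Base N × ℝ)

/-- `U` has a Lipschitz boundary: near every boundary point, for a suitable direction `e`, the set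
`U` is the part lying strictly above the graph of a Lipschitz function of the component
orthogonal to `e`. -/
def HasLipschitzBoundary {N : ℕ} (U : Set (Base N)) : Prop :=
  ∀ x ∈ frontier U, ∃ (e : Base N) (γ : Base N → ℝ) (K : NNReal) (V : Set (Base N)),
    ‖e‖ = 1 ∧ LipschitzWith K γ ∧ IsOpen V ∧ x ∈ V ∧
      ∀ z ∈ V, (z ∈ U ↔ γ (z - inner ℝ e z • e) < inner ℝ e z)

/-- The open cylinder `𝒞 = Ω × (0, ∞)`. -/
def cylinder {N : ℕ} (Ω : Set (Base N)) : Set (Ext N) := Ω ×ˢ Ioi (0 : ℝ)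

/-- The lateral boundary `∂Ω × [0, ∞)` of the cylinder. -/
def lateralBoundary {N : ℕ} (Ω : Set (Base N)) : Set (Ext N) := frontier Ω ×ˢ Ici (0 : ℝ)

/-- The measure `ρ dX` on `U`, so that `eLpNorm f p (weightedMeasure U ρ)` is the norm of
`L^p(U, ρ)` and `MemLp f p (weightedMeasure U ρ)` is membership in that space. -/
def weightedMeasure {N : ℕ} (U : Set (Ext N)) (ρ : Ext N → ℝ) : Measure (Ext N) :=
  (volume.restrict U).withDensity fun X => ENNReal.ofReal (ρ X)

/-- `g` is a weak gradient of `u` in the open set `U`. -/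
def IsWeakGradient {N : ℕ} (U : Set (Ext N)) (u : Ext N → ℝ) (g : Ext N → ExtVec N) : Prop :=
  LocallyIntegrableOn u U volume ∧ LocallyIntegrableOn g U volume ∧
    ∀ φ : Ext N → ℝ, ContDiff ℝ ∞ φ → HasCompactSupport φ → tsupport φ ⊆ U →
      ∀ v : Ext N, ∫ X in U, u X * fderiv ℝ φ X v =
        - ∫ X in U, inner ℝ (g X) (WithLp.toLp 2 v) * φ X

open Classical in
/-- The weak gradient of `u` in `U` (unique up to null sets where it exists, which is the only
case in which it is used). -/
def weakGrad {N : ℕ} (U : Set (Ext N)) (u : Ext N → ℝ) : Ext N → ExtVec N :=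
  if h : ∃ g, IsWeakGradient U u g then h.choose else 0

/-- Membership in the weighted Sobolev space `W^{1,p}(U, ρ)`. -/
def MemSobolev {N : ℕ} (U : Set (Ext N)) (ρ : Ext N → ℝ) (p : ℝ≥0∞) (u : Ext N → ℝ) : Prop :=
  MemLp u p (weightedMeasure U ρ) ∧ (∃ g, IsWeakGradient U u g) ∧
    MemLp (weakGrad U u) p (weightedMeasure U ρ)

/-- The norm of `W^{1,p}(U, ρ)`, for `1 ≤ p < ∞`. -/
def sobolevNorm {N : ℕ} (U : Set (Ext N)) (ρ : Ext N → ℝ) (p : ℝ≥0∞) (u : Ext N → ℝ) : ℝ≥0∞ :=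
  (eLpNorm u p (weightedMeasure U ρ) ^ p.toReal
    + eLpNorm (weakGrad U u) p (weightedMeasure U ρ) ^ p.toReal) ^ (1 / p.toReal)

/-- The class `C_c^∞(𝒞_Ω)` of functions smooth up to the boundary of the cylinder whose support
(the closure of the set of points of `closure 𝒞` where they do not vanish) does not meet the
lateral boundary. -/
def IsCapSmooth {N : ℕ} (Ω : Set (Base N)) (φ : Ext N → ℝ) : Prop :=
  ContDiffOn ℝ ∞ φ (closure (cylinder Ω)) ∧
    Disjoint (closure (Function.support φ ∩ closure (cylinder Ω))) (lateralBoundary Ω)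

/-- Membership in `ℋ^{1,p}_{0,L}(𝒞, w)`, the closure in `W^{1,p}(𝒞, w)` of
`C_c^∞(𝒞_Ω) ∩ W^{1,p}(𝒞, w)`. -/
def MemH {N : ℕ} (Ω : Set (Base N)) (w : Ext N → ℝ) (p : ℝ≥0∞) (u : Ext N → ℝ) : Prop :=
  MemSobolev (cylinder Ω) w p u ∧
    ∀ ε : ℝ≥0∞, 0 < ε → ∃ φ : Ext N → ℝ, IsCapSmooth Ω φ ∧ MemSobolev (cylinder Ω) w p φ ∧
      sobolevNorm (cylinder Ω) w p (u - φ) < ε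

/-- The step function `∑ i, σ i * 1_{P i}`. -/
def stepFun {N M : ℕ} (P : Fin M → Set (Base N)) (σ : Fin M → ℝ) (x : Base N) : ℝ :=
  ∑ i, (P i).indicator (fun _ => σ i) x

/-- The constant `2^(2 s̄ - 1) Γ(s̄) / Γ(1 - s̄)`, where `s̄` is the mean value of `s` over `Ω`. -/
def meanConst {N : ℕ} (Ω : Set (Base N)) (s : Base N → ℝ) : ℝ :=
  2 ^ (2 * (⨍ x in Ω, s x) - 1) * Real.Gamma (⨍ x in Ω, s x) / Real.Gamma (1 - ⨍ x in Ω, s x)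

/-- The weight `w(x, y) = G(x) y^(1 - 2 s(x))`. -/
def extWeight {N : ℕ} (G s : Base N → ℝ) (X : Ext N) : ℝ :=
  G X.1 * X.2 ^ (1 - 2 * s X.1)

/-- The weight `w` for the step function `s = ∑ i, σ i * 1_{P i}`, with the constant coefficient
`G = 2^(2 s̄ - 1) Γ(s̄) / Γ(1 - s̄)`. -/
def stepWeight {N M : ℕ} (Ω : Set (Base N)) (P : Fin M → Set (Base N)) (σ : Fin M → ℝ) :
    Ext N → ℝ :=
  extWeight (fun _ => meanConst Ω (stepFun P σ)) (stepFun P σ)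

end VarFrac

end

/-! Above a fixed piece `P i` the weight depends on `y` only: it is a constant times `y ^ (1 - 2 * σ
i)`. For a smooth `φ` vanishing near the lateral boundary, each slice `φ(·, y)` with `y > 0`
vanishes near `∂P i ∩ ∂Ω`, so the unweighted Poincaré inequality on `P i` applies to it. Multiplying
by the weight and integrating in `y` puts the same factor on both sides; hence the constant does not
see `σ`. Summing over the pieces (their frontiers are null) and passing to limits in the Sobolev
norm finishes the proof (`IsCapSmooth.setLIntegral_cylinder_le`,
`eLpNorm_le_mul_weakGrad_of_approx`).

The Poincaré inequality `poincareOn_vanishingNear` uses neither traces nor compact embeddings, only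
translations: replacing `f(x)` by `f(x + v)` along segments inside `U` costs a multiple of `∫
|Df|^q`. Segments issued from a boundary portion of positive measure sweep out a set of positive
volume on which `f` is controlled; averaging over translations carries the control to a ball, chains
of balls carry it through the connected set, and the Lipschitz boundary allows frontier points to be
pushed inside. Compactness of the closure makes the number of steps finite. -/

namespace VarFrac

/-! ### Comparing a function with its translates -/

section Translation

variable {E : Type*} [NormedAddCommGroup E] [NormedSpace ℝ E]

/-- The `q`-th power of the norm of the derivative of `f` in `U`, extended by zero. -/
noncomputable def derivPow (U : Set E) (q : ℝ) (f : E → ℝ) : E → ℝ≥0∞ :=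
  U.indicator fun z => ‖fderiv ℝ f z‖ₑ ^ q

/-- The fundamental theorem of calculus on `[0, a]`. The bound integrates over all of `(0, 1]`, with
the derivative extended by zero outside `U`, so that it no longer involves `a`; later `a` varies
with `x`. -/
lemma enorm_sub_le_lintegral_fderiv {U : Set E} (hU : IsOpen U) {f : E → ℝ}
    (hf : ContDiffOn ℝ 1 f U) {x v : E} {a : ℝ} (ha : a ∈ Icc (0 : ℝ) 1)
    (hx : ∀ t ∈ Icc 0 a, x + t • v ∈ U) :
    ‖f (x + a • v) - f x‖ₑ ≤ ‖v‖ₑ *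
      ∫⁻ t in Ioc (0 : ℝ) 1, U.indicator (fun z => ‖fderiv ℝ f z‖ₑ) (x + t • v) := by
  have hline : ∀ t : ℝ, HasDerivAt (fun t : ℝ => x + t • v) v t := fun t => by
    simpa using ((hasDerivAt_id t).smul_const v).const_add x
  have hcont : ContinuousOn (fun t : ℝ => fderiv ℝ f (x + t • v) v) (uIcc 0 a) := by
    rw [uIcc_of_le ha.1]
    have h1 : ContinuousOn (fderiv ℝ f) U := hf.continuousOn_fderiv_of_isOpen hU le_rfl
    have h2 : ContinuousOn (fun t : ℝ => fderiv ℝ f (x + t • v)) (Icc 0 a) :=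
      h1.comp (by fun_prop) hx
    exact h2.clm_apply continuousOn_const
  have hftc := intervalIntegral.integral_eq_sub_of_hasDerivAt
    (f := fun t : ℝ => f (x + t • v)) (f' := fun t => fderiv ℝ f (x + t • v) v)
    (a := 0) (b := a) (fun t ht => by
      rw [uIcc_of_le ha.1] at ht
      have hd : DifferentiableAt ℝ f (x + t • v) :=
        (hf.differentiableOn one_ne_zero).differentiableAt (hU.mem_nhds (hx t ht))
      exact hd.hasFDerivAt.comp_hasDerivAt t (hline t)) hcont.intervalIntegrable
  simp only [zero_smul, add_zero] at hftc
  rw [← hftc, intervalIntegral.integral_of_le ha.1]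
  calc ‖∫ t in Ioc 0 a, fderiv ℝ f (x + t • v) v‖ₑ
      ≤ ∫⁻ t in Ioc 0 a, ‖fderiv ℝ f (x + t • v) v‖ₑ := enorm_integral_le_lintegral_enorm _
    _ ≤ ∫⁻ t in Ioc 0 a, ‖v‖ₑ * U.indicator (fun z => ‖fderiv ℝ f z‖ₑ) (x + t • v) := by
        refine setLIntegral_mono' measurableSet_Ioc fun t ht => ?_
        rw [indicator_of_mem (hx t ⟨ht.1.le, ht.2⟩), mul_comm]
        exact (fderiv ℝ f (x + t • v)).le_opENorm v
    _ ≤ ∫⁻ t in Ioc (0 : ℝ) 1,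
          ‖v‖ₑ * U.indicator (fun z => ‖fderiv ℝ f z‖ₑ) (x + t • v) :=
        lintegral_mono_set (Ioc_subset_Ioc_right ha.2)
    _ = _ := lintegral_const_mul' _ _ enorm_ne_top

variable [MeasurableSpace E] [BorelSpace E]

lemma measurable_derivPow {U : Set E} (hU : IsOpen U) (q : ℝ) (f : E → ℝ) :
    Measurable (derivPow U q f) :=
  (((measurable_fderiv ℝ f).enorm).pow_const q).indicator hU.measurableSet

lemma lintegral_derivPow {U : Set E} (hU : IsOpen U) (q : ℝ) (f : E → ℝ) (μ : Measure E) :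
    ∫⁻ x, derivPow U q f x ∂μ = ∫⁻ x in U, ‖fderiv ℝ f x‖ₑ ^ q ∂μ :=
  lintegral_indicator hU.measurableSet _

lemma lintegral_rpow_le_of_isProbabilityMeasure {α : Type*} [MeasurableSpace α]
    (μ : Measure α) [IsProbabilityMeasure μ] {q : ℝ} (hq : 1 ≤ q) {g : α → ℝ≥0∞}
    (hg : Measurable g) : (∫⁻ x, g x ∂μ) ^ q ≤ ∫⁻ x, g x ^ q ∂μ := by
  have hq0 : 0 < q := by linarith
  have h := eLpNorm'_le_eLpNorm'_of_exponent_le (f := g) (p := 1) (q := q) one_pos hq μ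
    hg.aestronglyMeasurable
  simp only [eLpNorm', enorm_eq_self, ENNReal.rpow_one, div_one] at h
  rwa [one_div, ENNReal.le_rpow_inv_iff hq0] at h

variable {U : Set E} {f : E → ℝ} {q : ℝ}

/-- Triangle inequality, then convexity of `s ↦ s ^ q` twice: once for the sum of two terms, once as
Jensen's inequality on `(0, 1]`. -/
lemma enorm_rpow_le_add_lintegral (hU : IsOpen U) (hf : ContDiffOn ℝ 1 f U) (hq : 1 ≤ q)
    {x v : E} {a : ℝ} (ha : a ∈ Icc (0 : ℝ) 1) (hx : ∀ t ∈ Icc 0 a, x + t • v ∈ U) :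
    ‖f x‖ₑ ^ q ≤ 2 ^ (q - 1) * (‖f (x + a • v)‖ₑ ^ q + ‖v‖ₑ ^ q *
      ∫⁻ t in Ioc (0 : ℝ) 1, derivPow U q f (x + t • v)) := by
  have hq0 : 0 < q := by linarith
  have h1 : ‖f x‖ₑ ≤ ‖f (x + a • v)‖ₑ + ‖v‖ₑ *
      ∫⁻ t in Ioc (0 : ℝ) 1, U.indicator (fun z => ‖fderiv ℝ f z‖ₑ) (x + t • v) := by
    have := enorm_sub_le_lintegral_fderiv hU hf ha hx
    calc ‖f x‖ₑ = ‖f (x + a • v) - (f (x + a • v) - f x)‖ₑ := by rw [sub_sub_cancel]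
      _ ≤ ‖f (x + a • v)‖ₑ + ‖f (x + a • v) - f x‖ₑ := enorm_sub_le
      _ ≤ _ := by gcongr
  have hm : Measurable fun t : ℝ => U.indicator (fun z => ‖fderiv ℝ f z‖ₑ) (x + t • v) :=
    (((measurable_fderiv ℝ f).enorm).indicator hU.measurableSet).comp
      (by fun_prop : Continuous fun t : ℝ => x + t • v).measurable
  have : IsProbabilityMeasure (volume.restrict (Ioc (0 : ℝ) 1)) := ⟨by simp⟩
  have h2 := lintegral_rpow_le_of_isProbabilityMeasure (volume.restrict (Ioc (0 : ℝ) 1)) hq hm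
  have h3 : ∀ z, U.indicator (fun z => ‖fderiv ℝ f z‖ₑ) z ^ q = derivPow U q f z := fun z => by
    by_cases hz : z ∈ U <;> simp [derivPow, hz, hq0]
  simp only [h3] at h2
  calc ‖f x‖ₑ ^ q ≤ _ := ENNReal.rpow_le_rpow h1 hq0.le
    _ ≤ _ := ENNReal.rpow_add_le_mul_rpow_add_rpow _ _ hq
    _ ≤ _ := by
        rw [ENNReal.mul_rpow_of_nonneg _ _ hq0.le]
        gcongr

variable [FiniteDimensional ℝ E] (μ : Measure E) [μ.IsAddHaarMeasure]

lemma measurable_lintegral_derivPow (hU : IsOpen U) (v : E) :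
    Measurable fun x => ∫⁻ t in Ioc (0 : ℝ) 1, derivPow U q f (x + t • v) := by
  have : Measurable fun z : E × ℝ => derivPow U q f (z.1 + z.2 • v) :=
    (measurable_derivPow hU q f).comp (by fun_prop)
  exact this.lintegral_prod_right'

/-- Tonelli: for each `t` the inner integral over `x` is translation invariant, and `t` ranges over
an interval of length one. -/
lemma lintegral_lintegral_derivPow (hU : IsOpen U) (v : E) :
    ∫⁻ x, (∫⁻ t in Ioc (0 : ℝ) 1, derivPow U q f (x + t • v)) ∂μ =
      ∫⁻ x in U, ‖fderiv ℝ f x‖ₑ ^ q ∂μ := by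
  have hm : Measurable fun z : E × ℝ => derivPow U q f (z.1 + z.2 • v) :=
    (measurable_derivPow hU q f).comp (by fun_prop)
  rw [lintegral_lintegral_swap hm.aemeasurable]
  simp_rw [lintegral_add_right_eq_self (μ := μ) (derivPow U q f), lintegral_derivPow hU]
  simp

/-- Comparison of `f` on `A` with `f` on segments issued from `A` in the direction `v`. -/
lemma setLIntegral_enorm_rpow_le (hU : IsOpen U) (hf : ContDiffOn ℝ 1 f U) (hq : 1 ≤ q)
    {A : Set E} (hA : MeasurableSet A) (v : E) (a : E → ℝ) (ha : ∀ x ∈ A, a x ∈ Icc (0 : ℝ) 1)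
    (hx : ∀ x ∈ A, ∀ t ∈ Icc 0 (a x), x + t • v ∈ U) :
    ∫⁻ x in A, ‖f x‖ₑ ^ q ∂μ ≤ 2 ^ (q - 1) * (∫⁻ x in A, ‖f (x + a x • v)‖ₑ ^ q ∂μ +
      ‖v‖ₑ ^ q * ∫⁻ x in U, ‖fderiv ℝ f x‖ₑ ^ q ∂μ) := by
  have hc : (2 : ℝ≥0∞) ^ (q - 1) ≠ ⊤ := ENNReal.rpow_ne_top_of_nonneg (by linarith) (by simp)
  have hv : ‖v‖ₑ ^ q ≠ ⊤ := ENNReal.rpow_ne_top_of_nonneg (by linarith) (by simp)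
  calc ∫⁻ x in A, ‖f x‖ₑ ^ q ∂μ
      ≤ ∫⁻ x in A, 2 ^ (q - 1) * (‖f (x + a x • v)‖ₑ ^ q + ‖v‖ₑ ^ q *
          ∫⁻ t in Ioc (0 : ℝ) 1, derivPow U q f (x + t • v)) ∂μ :=
        setLIntegral_mono' hA fun x hxA =>
          enorm_rpow_le_add_lintegral hU hf hq (ha x hxA) (hx x hxA)
    _ = 2 ^ (q - 1) * (∫⁻ x in A, ‖f (x + a x • v)‖ₑ ^ q ∂μ + ‖v‖ₑ ^ q *
          ∫⁻ x in A, (∫⁻ t in Ioc (0 : ℝ) 1, derivPow U q f (x + t • v)) ∂μ) := by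
        -- Splitting the integral needs only the derivative term to be measurable, so nothing is
        -- required of `a`.
        rw [lintegral_const_mul' _ _ hc, lintegral_add_right _
          ((measurable_lintegral_derivPow hU v).const_mul _), lintegral_const_mul' _ _ hv]
    _ ≤ _ := by
        refine mul_le_mul_right (add_le_add le_rfl (mul_le_mul_right ?_ _)) _
        exact (setLIntegral_le_lintegral _ _).trans (lintegral_lintegral_derivPow μ hU v).le

end Translation

/-! ### Spreading an estimate over a connected set -/

section PoincareOn

open Filter Topology Metric

variable {E : Type*} [NormedAddCommGroup E] [NormedSpace ℝ E] [MeasurableSpace E]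

/-- The functions of the class `F` are controlled in `L^q(S ∩ U)` by their derivatives in
`L^q(U)`, uniformly in `F`. -/
def PoincareOn (F : Set (E → ℝ)) (U : Set E) (q : ℝ) (μ : Measure E) (S : Set E) : Prop :=
  ∃ C : ℝ≥0∞, C ≠ ⊤ ∧ ∀ f ∈ F,
    ∫⁻ x in S ∩ U, ‖f x‖ₑ ^ q ∂μ ≤ C * ∫⁻ x in U, ‖fderiv ℝ f x‖ₑ ^ q ∂μ

variable {F : Set (E → ℝ)} {U S T : Set E} {q : ℝ} {μ : Measure E}

lemma PoincareOn.mono (hT : PoincareOn F U q μ T) (h : S ∩ U ⊆ T) : PoincareOn F U q μ S := by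
  obtain ⟨C, hC, hT⟩ := hT
  exact ⟨C, hC, fun f hf => (lintegral_mono_set (subset_inter h inter_subset_right)).trans (hT f hf)⟩

lemma PoincareOn.union (hS : PoincareOn F U q μ S) (hT : PoincareOn F U q μ T) :
    PoincareOn F U q μ (S ∪ T) := by
  obtain ⟨C, hC, hS⟩ := hS
  obtain ⟨D, hD, hT⟩ := hT
  refine ⟨C + D, ENNReal.add_ne_top.2 ⟨hC, hD⟩, fun f hf => ?_⟩
  rw [union_inter_distrib_right, add_mul]
  exact (lintegral_union_le _ _ _).trans (add_le_add (hS f hf) (hT f hf))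

/-- The property is monotone and stable under finite unions (constants add), so a finite subcover
suffices. -/
lemma PoincareOn.of_isCompact (hU : IsCompact (closure U))
    (h : ∀ x ∈ closure U, ∃ V ∈ 𝓝 x, PoincareOn F U q μ V) : PoincareOn F U q μ U := by
  refine PoincareOn.mono (T := closure U) ?_ (inter_subset_left.trans subset_closure)
  refine hU.induction_on (p := PoincareOn F U q μ) ⟨0, by simp, fun f _ => by simp⟩
    (fun s t hst ht => ht.mono (inter_subset_left.trans hst)) (fun s t hs ht => hs.union ht) ?_
  intro x hx
  obtain ⟨V, hV, hP⟩ := h x hx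
  exact ⟨V, mem_nhdsWithin_of_mem_nhds hV, hP⟩

variable [BorelSpace E] [FiniteDimensional ℝ E] [μ.IsAddHaarMeasure]

omit [NormedSpace ℝ E] [FiniteDimensional ℝ E] in
lemma setLIntegral_comp_add_right_le {A : Set E} {v : E} (hA : MeasurableSet A)
    (h : ∀ x ∈ A, x + v ∈ S) (g : E → ℝ≥0∞) :
    ∫⁻ x in A, g (x + v) ∂μ ≤ ∫⁻ x in S, g x ∂μ := by
  calc ∫⁻ x in A, g (x + v) ∂μ = ∫⁻ x, A.indicator (fun x => g (x + v)) x ∂μ :=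
        (lintegral_indicator hA _).symm
    _ ≤ ∫⁻ x, S.indicator g (x + v) ∂μ := by
        refine lintegral_mono fun x => ?_
        by_cases hx : x ∈ A
        · simp [hx, h x hx]
        · simp [hx]
    _ = ∫⁻ x, S.indicator g x ∂μ := lintegral_add_right_eq_self _ v
    _ ≤ _ := lintegral_indicator_le _ _

lemma PoincareOn.translate (hU : IsOpen U) (hF : ∀ f ∈ F, ContDiffOn ℝ 1 f U) (hq : 1 ≤ q)
    (hS : PoincareOn F U q μ S) {A : Set E} (hA : MeasurableSet A) (v : E)
    (hAS : ∀ x ∈ A, x + v ∈ S) (hAU : ∀ x ∈ A, ∀ t ∈ Icc (0 : ℝ) 1, x + t • v ∈ U) :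
    PoincareOn F U q μ A := by
  obtain ⟨C, hC, hS⟩ := hS
  have hc : (2 : ℝ≥0∞) ^ (q - 1) ≠ ⊤ := ENNReal.rpow_ne_top_of_nonneg (by linarith) (by simp)
  have hv : ‖v‖ₑ ^ q ≠ ⊤ := ENNReal.rpow_ne_top_of_nonneg (by linarith) (by simp)
  refine ⟨2 ^ (q - 1) * (C + ‖v‖ₑ ^ q), ENNReal.mul_ne_top hc (ENNReal.add_ne_top.2 ⟨hC, hv⟩),
    fun f hf => ?_⟩
  calc ∫⁻ x in A ∩ U, ‖f x‖ₑ ^ q ∂μ ≤ ∫⁻ x in A, ‖f x‖ₑ ^ q ∂μ :=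
        lintegral_mono_set inter_subset_left
    _ ≤ 2 ^ (q - 1) * (∫⁻ x in A, ‖f (x + (1 : ℝ) • v)‖ₑ ^ q ∂μ +
          ‖v‖ₑ ^ q * ∫⁻ x in U, ‖fderiv ℝ f x‖ₑ ^ q ∂μ) :=
        setLIntegral_enorm_rpow_le μ hU (hF f hf) hq hA v (fun _ => 1) (fun _ _ => by simp) hAU
    _ ≤ 2 ^ (q - 1) * (C * ∫⁻ x in U, ‖fderiv ℝ f x‖ₑ ^ q ∂μ +
          ‖v‖ₑ ^ q * ∫⁻ x in U, ‖fderiv ℝ f x‖ₑ ^ q ∂μ) := by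
        gcongr
        simp only [one_smul]
        refine (setLIntegral_comp_add_right_le (S := S ∩ U) hA (fun x hx => ⟨hAS x hx, ?_⟩)
          (fun x => ‖f x‖ₑ ^ q)).trans (hS f hf)
        simpa using hAU x hx 1 (by simp)
    _ = _ := by ring

/-- Averaging over translations: an estimate on a set of positive measure gives one on a ball. -/
lemma PoincareOn.exists_ball (hU : IsOpen U) (hF : ∀ f ∈ F, ContDiffOn ℝ 1 f U) (hq : 1 ≤ q)
    (hS : PoincareOn F U q μ S) (hSm : MeasurableSet S) (hpos : μ (S ∩ U) ≠ 0) :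
    ∃ x ∈ U, ∃ r > 0, ball x r ⊆ U ∧ PoincareOn F U q μ (ball x r) := by
  -- A point all of whose neighbourhoods meet `S ∩ U` in positive measure; then `V` below is not
  -- null.
  obtain ⟨x₀, hx₀, hx₀pos⟩ := exists_mem_forall_mem_nhdsWithin_pos_measure hpos
  obtain ⟨r, hr, hrU⟩ := Metric.isOpen_iff.1 hU x₀ hx₀.2
  refine ⟨x₀, hx₀.2, r, hr, hrU, ?_⟩
  obtain ⟨C, hC, hS⟩ := hS
  set D := ball x₀ r
  set V := (S ∩ U) ∩ D
  set W := ball (0 : E) (2 * r)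
  have hVm : MeasurableSet V := (hSm.inter hU.measurableSet).inter isOpen_ball.measurableSet
  have hV0 : μ V ≠ 0 := (hx₀pos V (inter_mem self_mem_nhdsWithin
    (mem_nhdsWithin_of_mem_nhds (ball_mem_nhds _ hr)))).ne'
  have hVtop : μ V ≠ ⊤ := ((measure_mono inter_subset_right).trans_lt measure_ball_lt_top).ne
  have hc : (2 : ℝ≥0∞) ^ (q - 1) ≠ ⊤ := ENNReal.rpow_ne_top_of_nonneg (by linarith) (by simp)
  set R : ℝ≥0∞ := ENNReal.ofReal (2 * r) ^ q
  have hR : R ≠ ⊤ :=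
    ENNReal.rpow_ne_top_of_nonneg (by linarith) ENNReal.ofReal_ne_top
  refine ⟨(μ V)⁻¹ * (μ W * (2 ^ (q - 1) * (C + R))), ?_, fun f hf => ?_⟩
  · exact ENNReal.mul_ne_top (ENNReal.inv_ne_top.2 hV0) (ENNReal.mul_ne_top measure_ball_lt_top.ne
      (ENNReal.mul_ne_top hc (ENNReal.add_ne_top.2 ⟨hC, hR⟩)))
  set I := ∫⁻ x in U, ‖fderiv ℝ f x‖ₑ ^ q ∂μ
  set g : E → ℝ≥0∞ := D.indicator fun x => ‖f x‖ₑ ^ q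
  have hg : Measurable g := by
    have : ContinuousOn (fun x => ‖f x‖ₑ ^ q) D :=
      ENNReal.continuous_rpow_const.comp_continuousOn
        (continuous_enorm.comp_continuousOn ((hF f hf).continuousOn.mono hrU))
    classical
    have h := this.measurable_piecewise (g := 0) continuousOn_const
      isOpen_ball.measurableSet
    simpa only [g, ← piecewise_eq_indicator] using h
  -- For fixed `v`, only points of the ball landing in `V` count; the ball is convex, so their
  -- segments stay in `U`.
  have key : ∀ v ∈ W, ∫⁻ x, g x * V.indicator 1 (x + v) ∂μ ≤ 2 ^ (q - 1) * (C + R) * I := by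
    intro v hv
    set A := D ∩ (fun x => x + v) ⁻¹' V
    have hA : MeasurableSet A :=
      isOpen_ball.measurableSet.inter ((measurable_add_const v) hVm)
    have h1 : ∫⁻ x, g x * V.indicator 1 (x + v) ∂μ = ∫⁻ x in A, ‖f x‖ₑ ^ q ∂μ := by
      rw [← lintegral_indicator hA]
      refine lintegral_congr fun x => ?_
      by_cases hx : x ∈ D <;> by_cases hx' : x + v ∈ V <;> simp [g, A, hx, hx']
    rw [h1]
    calc ∫⁻ x in A, ‖f x‖ₑ ^ q ∂μ
        ≤ 2 ^ (q - 1) * (∫⁻ x in A, ‖f (x + (1 : ℝ) • v)‖ₑ ^ q ∂μ + ‖v‖ₑ ^ q * I) := by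
          refine setLIntegral_enorm_rpow_le μ hU (hF f hf) hq hA v (fun _ => 1)
            (fun _ _ => by simp) fun x hx t ht => hrU ?_
          exact (convex_ball x₀ r).add_smul_mem hx.1 hx.2.2 ht
      _ ≤ 2 ^ (q - 1) * (C * I + R * I) := by
          gcongr
          · simp only [one_smul]
            exact (setLIntegral_comp_add_right_le (S := S ∩ U) hA (fun x hx => hx.2.1)
              (fun x => ‖f x‖ₑ ^ q)).trans (hS f hf)
          · refine ENNReal.rpow_le_rpow ?_ (by linarith)
            rw [← ofReal_norm]
            exact ENNReal.ofReal_le_ofReal (by simpa [W] using (mem_ball.1 hv).le)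
      _ = _ := by ring
  -- The translations taking `x` into `V` have total measure `μ V`, and they all lie in `W` because
  -- two points of `D` differ by less than `2 * r`.
  have hsum : ∀ x, g x * μ V = ∫⁻ v in W, g x * V.indicator 1 (x + v) ∂μ := by
    intro x
    by_cases hx : x ∈ D
    · have hgx : g x ≠ ⊤ := by
        simp only [g, indicator_of_mem hx]
        exact ENNReal.rpow_ne_top_of_nonneg (by linarith) (by simp)
      rw [lintegral_const_mul' _ _ hgx]
      congr 1
      have : ∀ v, V.indicator (1 : E → ℝ≥0∞) (x + v)
          = ((fun v => x + v) ⁻¹' V).indicator 1 v := fun v => rfl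
      simp_rw [this]
      rw [lintegral_indicator_one ((measurable_const_add x) hVm), Measure.restrict_apply
        ((measurable_const_add x) hVm), inter_eq_left.2, measure_preimage_add]
      intro v hv
      have h1 : dist (x + v) x₀ < r := mem_ball.1 hv.2
      have h2 : dist x x₀ < r := mem_ball.1 hx
      have h3 : dist (x + v) x ≤ dist (x + v) x₀ + dist x x₀ := dist_triangle_right _ _ _
      have h4 : dist (x + v) x = ‖v‖ := by simp [dist_eq_norm]
      simp only [W, mem_ball, dist_zero_right]
      linarith
    · simp [g, hx]
  have hmain : (∫⁻ x in D ∩ U, ‖f x‖ₑ ^ q ∂μ) * μ V ≤ μ W * (2 ^ (q - 1) * (C + R) * I) := by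
    calc (∫⁻ x in D ∩ U, ‖f x‖ₑ ^ q ∂μ) * μ V
        ≤ (∫⁻ x, g x ∂μ) * μ V := by
          rw [lintegral_indicator isOpen_ball.measurableSet]
          gcongr
          exact inter_subset_left
      _ = ∫⁻ x, ∫⁻ v in W, g x * V.indicator 1 (x + v) ∂μ ∂μ := by
          rw [← lintegral_mul_const _ hg]
          exact lintegral_congr hsum
      _ = ∫⁻ v in W, ∫⁻ x, g x * V.indicator 1 (x + v) ∂μ ∂μ := by
          refine lintegral_lintegral_swap (Measurable.aemeasurable ?_)
          have h1 : Measurable (V.indicator (1 : E → ℝ≥0∞)) := measurable_one.indicator hVm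
          exact (hg.comp measurable_fst).mul
            (h1.comp (by fun_prop : Measurable fun z : E × E => z.1 + z.2))
      _ ≤ ∫⁻ v in W, 2 ^ (q - 1) * (C + R) * I ∂μ :=
          setLIntegral_mono' isOpen_ball.measurableSet key
      _ = _ := by rw [setLIntegral_const, mul_comm]
  calc ∫⁻ x in D ∩ U, ‖f x‖ₑ ^ q ∂μ
      = (μ V)⁻¹ * ((∫⁻ x in D ∩ U, ‖f x‖ₑ ^ q ∂μ) * μ V) := by
        rw [mul_comm _ (μ V), ← mul_assoc, ENNReal.inv_mul_cancel hV0 hVtop, one_mul]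
    _ ≤ (μ V)⁻¹ * (μ W * (2 ^ (q - 1) * (C + R) * I)) := by gcongr
    _ = _ := by ring

/-- Chaining balls: an estimate on one ball gives local estimates in a connected open set. -/
lemma PoincareOn.exists_ball_of_isPreconnected (hU : IsOpen U) (hUc : IsPreconnected U)
    (hF : ∀ f ∈ F, ContDiffOn ℝ 1 f U) (hq : 1 ≤ q)
    (h : ∃ x ∈ U, ∃ r > 0, ball x r ⊆ U ∧ PoincareOn F U q μ (ball x r)) :
    ∀ x ∈ U, ∃ r > 0, ball x r ⊆ U ∧ PoincareOn F U q μ (ball x r) := by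
  set G : Set E := {x | ∃ r > 0, ball x r ⊆ U ∧ PoincareOn F U q μ (ball x r)}
  have hGo : IsOpen G := by
    refine Metric.isOpen_iff.2 fun x ⟨r, hr, hrU, hP⟩ => ⟨r, hr, fun y hy => ?_⟩
    have hsub : ball y (r - dist y x) ⊆ ball x r := ball_subset_ball' (by linarith)
    exact ⟨r - dist y x, by linarith [mem_ball.1 hy], hsub.trans hrU,
      hP.mono (inter_subset_left.trans hsub)⟩
  -- The good points form a nonempty open set; it remains to see that it is closed relative to `U`.
  -- A small ball about a limit point `x` is moved into a good ball about a nearby `y`, within `ball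
  -- x r`.
  refine hUc.subset_of_closure_inter_subset hGo ?_ ?_
  · obtain ⟨x, hx, hG⟩ := h
    exact ⟨x, hx, hG⟩
  · rintro x ⟨hxG, hxU⟩
    obtain ⟨r, hr, hrU⟩ := Metric.isOpen_iff.1 hU x hxU
    obtain ⟨y, ⟨ρ, hρ, -, hP⟩, hxy⟩ := Metric.mem_closure_iff.1 hxG (r / 2) (by linarith)
    have hsub : ball x (min ρ (r / 2)) ⊆ U :=
      (ball_subset_ball ((min_le_right _ _).trans (by linarith))).trans hrU
    refine ⟨min ρ (r / 2), lt_min hρ (by linarith), hsub, ?_⟩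
    refine hP.translate hU hF hq isOpen_ball.measurableSet (y - x) (fun z hz => ?_)
      fun z hz t ht => hrU ?_
    · rw [mem_ball, dist_eq_norm] at hz ⊢
      rw [show z + (y - x) - y = z - x by abel]
      exact hz.trans_le (min_le_left _ _)
    · rw [mem_ball, dist_eq_norm] at hz ⊢
      rw [dist_comm, dist_eq_norm] at hxy
      calc ‖z + t • (y - x) - x‖ = ‖(z - x) + t • (y - x)‖ := by congr 1; abel
        _ ≤ ‖z - x‖ + ‖t • (y - x)‖ := norm_add_le _ _
        _ ≤ ‖z - x‖ + ‖y - x‖ := by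
            rw [norm_smul, Real.norm_of_nonneg ht.1]
            nlinarith [norm_nonneg (y - x), ht.2]
        _ < r := by linarith [hz.trans_le (min_le_right _ _)]

/-- Every frontier point of `U` has a neighbourhood which can be moved into `U` inside `U`. -/
def HasInwardTranslations (U : Set E) : Prop :=
  ∀ x ∈ frontier U, ∃ v : E, ∃ V ∈ 𝓝 x, x + v ∈ U ∧
    ∀ z ∈ V ∩ U, ∀ t ∈ Icc (0 : ℝ) 1, z + t • v ∈ U

/-- Interior points are reached by chaining balls. Near a frontier point `x`, the part in `U` is
translated by `v` into a good ball about the interior point `x + v`. -/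
lemma PoincareOn.of_pos_measure (hU : IsOpen U) (hUc : IsPreconnected U)
    (hUb : Bornology.IsBounded U) (hUt : HasInwardTranslations U)
    (hF : ∀ f ∈ F, ContDiffOn ℝ 1 f U) (hq : 1 ≤ q)
    (hS : PoincareOn F U q μ S) (hSm : MeasurableSet S) (hpos : μ (S ∩ U) ≠ 0) :
    PoincareOn F U q μ U := by
  have hloc := PoincareOn.exists_ball_of_isPreconnected hU hUc hF hq
    (hS.exists_ball hU hF hq hSm hpos)
  refine PoincareOn.of_isCompact hUb.isCompact_closure fun x hx => ?_
  by_cases hxU : x ∈ U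
  · obtain ⟨r, hr, -, hP⟩ := hloc x hxU
    exact ⟨_, ball_mem_nhds x hr, hP⟩
  · obtain ⟨v, V, hV, hxv, hVU⟩ := hUt x (by rw [hU.frontier_eq]; exact ⟨hx, hxU⟩)
    obtain ⟨r, hr, -, hP⟩ := hloc _ hxv
    obtain ⟨O, hOV, hO, hxO⟩ := _root_.mem_nhds_iff.1 hV
    refine ⟨O ∩ ball x r, inter_mem (hO.mem_nhds hxO) (ball_mem_nhds x hr), ?_⟩
    have hPA : PoincareOn F U q μ (O ∩ ball x r ∩ U) := by
      refine hP.translate hU hF hq ((hO.inter isOpen_ball).inter hU).measurableSet v ?_ ?_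
      · rintro z ⟨⟨-, hz⟩, -⟩
        simpa using hz
      · rintro z ⟨⟨hz, -⟩, hzU⟩
        exact hVU z ⟨hOV hz, hzU⟩
    exact hPA.mono subset_rfl

end PoincareOn

/-! ### Lipschitz graphs and Poincaré's inequality in a Lipschitz domain -/

section LipschitzBoundary

open Filter Topology Metric Module

variable {N : ℕ} {U V : Set (Base N)} {e : Base N} {γ : Base N → ℝ} {K : NNReal}

/-- The component of `z` orthogonal to `e`, as an element of the orthogonal complement of `e`. -/
noncomputable def orthProj (he : ‖e‖ = 1) : Base N →L[ℝ] (ℝ ∙ e)ᗮ :=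
  (ContinuousLinearMap.id ℝ (Base N) - (innerSL ℝ e).smulRight e).codRestrict _ fun z => by
    rw [Submodule.mem_orthogonal_singleton_iff_inner_right]
    simp [inner_sub_right, inner_smul_right, he]

lemma coe_orthProj (he : ‖e‖ = 1) (z : Base N) :
    (orthProj he z : Base N) = z - inner ℝ e z • e := rfl

lemma inner_add_smul_self (he : ‖e‖ = 1) (z : Base N) (t : ℝ) :
    inner ℝ e (z + t • e) = inner ℝ e z + t := by
  simp [inner_add_right, inner_smul_right, he]

lemma sub_inner_add_smul_self (he : ‖e‖ = 1) (z : Base N) (t : ℝ) :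
    z + t • e - inner ℝ e (z + t • e) • e = z - inner ℝ e z • e := by
  rw [inner_add_smul_self he, add_smul]
  abel

lemma eq_inner_of_mem_frontier (hU : IsOpen U) (hγ : LipschitzWith K γ) (hV : IsOpen V)
    (h : ∀ z ∈ V, (z ∈ U ↔ γ (z - inner ℝ e z • e) < inner ℝ e z)) {x : Base N} (hx : x ∈ V)
    (hxU : x ∈ frontier U) : γ (x - inner ℝ e x • e) = inner ℝ e x := by
  rw [hU.frontier_eq] at hxU
  refine le_antisymm ?_ (not_lt.1 fun hlt => hxU.2 ((h x hx).2 hlt))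
  have hclosed : IsClosed {z : Base N | γ (z - inner ℝ e z • e) ≤ inner ℝ e z} :=
    isClosed_le (hγ.continuous.comp (by fun_prop)) (by fun_prop)
  refine closure_minimal (s := V ∩ U) (fun z hz => ((h z hz.1).1 hz.2).le) hclosed ?_
  exact hV.inter_closure ⟨hx, hxU.1⟩

/-- Moving along `e` fixes the orthogonal component and raises the height, so points above the graph
stay above it. -/
lemma HasLipschitzBoundary.hasInwardTranslations (hU : IsOpen U) (h : HasLipschitzBoundary U) :
    HasInwardTranslations U := by
  intro x hx
  obtain ⟨e, γ, K, V, he, hγ, hV, hxV, hVU⟩ := h x hx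
  obtain ⟨r, hr, hrV⟩ := Metric.isOpen_iff.1 hV x hxV
  have hmem : ∀ z ∈ ball x (r / 2), ∀ t ∈ Icc (0 : ℝ) 1, z + t • (r / 2) • e ∈ V := by
    intro z hz t ht
    apply hrV
    rw [mem_ball, dist_eq_norm] at hz ⊢
    calc ‖z + t • (r / 2) • e - x‖ = ‖(z - x) + t • (r / 2) • e‖ := by congr 1; abel
      _ ≤ ‖z - x‖ + ‖t • (r / 2) • e‖ := norm_add_le _ _
      _ < r := by
        rw [norm_smul, norm_smul, he, Real.norm_of_nonneg ht.1, Real.norm_of_nonneg (by linarith)]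
        nlinarith [ht.2]
  refine ⟨(r / 2) • e, ball x (r / 2), ball_mem_nhds x (by linarith), ?_, ?_⟩
  · have hV1 := hmem x (mem_ball_self (by linarith)) 1 (by simp)
    rw [one_smul] at hV1
    rw [hVU _ hV1, sub_inner_add_smul_self he, inner_add_smul_self he,
      eq_inner_of_mem_frontier hU hγ hV hVU hxV hx]
    linarith
  · rintro z ⟨hz, hzU⟩ t ht
    have hzV : z ∈ V := hrV (ball_subset_ball (by linarith) hz)
    have hV1 := hmem z hz t ht
    rw [hVU _ hV1, smul_smul, sub_inner_add_smul_self he, inner_add_smul_self he]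
    have h1 := (hVU z hzV).1 hzU
    have h2 : 0 ≤ t * (r / 2) := mul_nonneg ht.1 (by linarith)
    linarith

lemma lipschitz_graph (hγ : LipschitzWith K γ) :
    ∃ C, LipschitzWith C fun w : (ℝ ∙ e)ᗮ => (w : Base N) + γ w • e := by
  have h1 : LipschitzWith 1 fun w : (ℝ ∙ e)ᗮ => (w : Base N) := LipschitzWith.subtype_val _
  have h2 := ((ContinuousLinearMap.toSpanSingleton ℝ e).lipschitz).comp (hγ.comp h1)
  exact ⟨_, h1.add h2⟩

lemma finrank_orthogonal_singleton (he : ‖e‖ = 1) : finrank ℝ (ℝ ∙ e)ᗮ + 1 = N := by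
  have he0 : e ≠ 0 := fun h => by simp [h] at he
  have h := (ℝ ∙ e).finrank_add_finrank_orthogonal
  rw [finrank_span_singleton he0, finrank_euclideanSpace_fin] at h
  omega

/-- The graph is a Lipschitz image of a space of dimension `N - 1`, so its Hausdorff dimension is
less than `N`. -/
lemma volume_graph (he : ‖e‖ = 1) (hγ : LipschitzWith K γ) :
    volume {z : Base N | γ (z - inner ℝ e z • e) = inner ℝ e z} = 0 := by
  obtain ⟨C, hC⟩ := lipschitz_graph (e := e) hγ
  have hsub : {z : Base N | γ (z - inner ℝ e z • e) = inner ℝ e z} ⊆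
      range fun w : (ℝ ∙ e)ᗮ => (w : Base N) + γ w • e := by
    intro z hz
    refine ⟨orthProj he z, ?_⟩
    have hz' : γ (z - inner ℝ e z • e) = inner ℝ e z := hz
    simp only [coe_orthProj, hz', sub_add_cancel]
  have hdim : dimH {z : Base N | γ (z - inner ℝ e z • e) = inner ℝ e z} < (N : NNReal) := by
    refine ((dimH_mono hsub).trans hC.dimH_range_le).trans_lt ?_
    rw [Real.dimH_univ_eq_finrank]
    have := finrank_orthogonal_singleton he
    exact_mod_cast (by omega : finrank ℝ (ℝ ∙ e)ᗮ < N)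
  have h0 := hausdorffMeasure_of_dimH_lt hdim
  have hN : ((N : NNReal) : ℝ) = finrank ℝ (Base N) := by simp
  rw [hN] at h0
  exact Measure.absolutelyContinuous_isAddHaarMeasure volume
    (Measure.hausdorffMeasure (finrank ℝ (Base N) : ℝ)) h0

lemma HasLipschitzBoundary.volume_frontier (hU : IsOpen U) (h : HasLipschitzBoundary U) :
    volume (frontier U) = 0 := by
  refine measure_null_of_locally_null _ fun x hx => ?_
  obtain ⟨e, γ, K, V, he, hγ, hV, hxV, hVU⟩ := h x hx
  refine ⟨V ∩ frontier U, inter_mem (mem_nhdsWithin_of_mem_nhds (hV.mem_nhds hxV))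
    self_mem_nhdsWithin, measure_mono_null ?_ (volume_graph he hγ)⟩
  exact fun z hz => eq_inner_of_mem_frontier hU hγ hV hVU hz.1 hz.2

/-- A set of positive `(N - 1)`-dimensional measure on a Lipschitz graph sweeps out a set of
positive volume. -/
lemma volume_sweep_ne_zero (he : ‖e‖ = 1) (hγ : LipschitzWith K γ) {S : Set (Base N)}
    (hS : ∀ z ∈ S, γ (z - inner ℝ e z • e) = inner ℝ e z)
    (hpos : (Measure.hausdorffMeasure ((N : ℝ) - 1) : Measure (Base N)) S ≠ 0) {a b : ℝ}
    (hab : a < b) : volume ((fun z : Base N × ℝ => z.1 + z.2 • e) '' S ×ˢ Icc a b) ≠ 0 := by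
  intro hnull
  apply hpos
  have hfin := finrank_orthogonal_singleton he
  have hN1 : (N : ℝ) - 1 = finrank ℝ (ℝ ∙ e)ᗮ := by
    rw [sub_eq_iff_eq_add]
    exact_mod_cast hfin.symm
  set D := (fun z : Base N × ℝ => z.1 + z.2 • e) '' S ×ˢ Icc a b
  -- `Ψ` flattens the graph. It is Lipschitz, hence preserves null sets, and the image of the swept
  -- set contains `orthProj he '' S × [a, b]`. If that product is null, so is the projection, and
  -- `S` is a Lipschitz image of it.
  let Ψ : Base N → (ℝ ∙ e)ᗮ × ℝ := fun z =>
    (orthProj he z, innerSL ℝ e z - γ ((orthProj he z : (ℝ ∙ e)ᗮ) : Base N))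
  have hΨ : ∃ C, LipschitzWith C Ψ :=
    ⟨_, (orthProj he).lipschitz.prodMk ((innerSL ℝ e).lipschitz.sub
      (hγ.comp ((LipschitzWith.subtype_val _).comp (orthProj he).lipschitz)))⟩
  obtain ⟨C, hC⟩ := hΨ
  have hD : (Measure.hausdorffMeasure (finrank ℝ (Base N) : ℝ)) D = 0 :=
    Measure.absolutelyContinuous_isAddHaarMeasure _ volume hnull
  have hΨD : (Measure.hausdorffMeasure (finrank ℝ ((ℝ ∙ e)ᗮ × ℝ) : ℝ)) (Ψ '' D) = 0 := by
    have hrank : finrank ℝ ((ℝ ∙ e)ᗮ × ℝ) = finrank ℝ (Base N) := by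
      rw [finrank_prod, finrank_self, hfin, finrank_euclideanSpace_fin]
    rw [hrank]
    have := hC.hausdorffMeasure_image_le (Nat.cast_nonneg (finrank ℝ (Base N))) D
    rw [hD, mul_zero] at this
    exact le_antisymm this zero_le
  set ν : Measure (ℝ ∙ e)ᗮ := Measure.hausdorffMeasure (finrank ℝ (ℝ ∙ e)ᗮ : ℝ)
  have hprod : (ν.prod volume) (Ψ '' D) = 0 :=
    Measure.absolutelyContinuous_isAddHaarMeasure (ν.prod volume) _ hΨD
  have hsub : (orthProj he '' S) ×ˢ Icc a b ⊆ Ψ '' D := by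
    rintro ⟨_, t⟩ ⟨⟨z, hz, rfl⟩, ht⟩
    refine ⟨z + t • e, ⟨(z, t), ⟨hz, ht⟩, rfl⟩, ?_⟩
    have h1 : orthProj he (z + t • e) = orthProj he z :=
      Subtype.ext (sub_inner_add_smul_self he z t)
    refine Prod.ext h1 ?_
    simp only [Ψ, h1, innerSL_apply_apply, inner_add_smul_self he, coe_orthProj, hS z hz]
    ring
  have hproj : ν (orthProj he '' S) = 0 := by
    have h1 := measure_mono_null hsub hprod
    rw [Measure.prod_prod, mul_eq_zero] at h1
    refine h1.resolve_right ?_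
    simpa using hab
  obtain ⟨C', hC'⟩ := lipschitz_graph (e := e) hγ
  have himg : S ⊆ (fun w : (ℝ ∙ e)ᗮ => (w : Base N) + γ w • e) '' (orthProj he '' S) := by
    intro z hz
    refine ⟨_, ⟨z, hz, rfl⟩, ?_⟩
    simp only [coe_orthProj, hS z hz, sub_add_cancel]
  rw [hN1]
  refine measure_mono_null himg ?_
  have := hC'.hausdorffMeasure_image_le (Nat.cast_nonneg (finrank ℝ (ℝ ∙ e)ᗮ)) (orthProj he '' S)
  rw [show Measure.hausdorffMeasure (finrank ℝ (ℝ ∙ e)ᗮ : ℝ) (orthProj he '' S) = 0 from hproj,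
    mul_zero] at this
  exact le_antisymm this zero_le

/-- The functions of class `C¹` in `U` which vanish near `Γ`. -/
def vanishingNear (U Γ : Set (Base N)) : Set (Base N → ℝ) :=
  {f | ContDiffOn ℝ 1 f U ∧ ∀ z ∈ Γ, ∀ᶠ x in 𝓝[U] z, f x = 0}

/-- Poincaré's inequality in a connected Lipschitz domain, for functions vanishing near a part of
the boundary of positive `(N - 1)`-dimensional measure. -/
theorem poincareOn_vanishingNear (hU : IsOpen U) (hUc : IsPreconnected U)
    (hUb : Bornology.IsBounded U) (hUL : HasLipschitzBoundary U) {Γ : Set (Base N)}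
    (hΓ : IsClosed Γ) (hΓU : Γ ⊆ frontier U)
    (hpos : (Measure.hausdorffMeasure ((N : ℝ) - 1) : Measure (Base N)) Γ ≠ 0)
    {q : ℝ} (hq : 1 ≤ q) : PoincareOn (vanishingNear U Γ) U q volume U := by
  have hF : ∀ f ∈ vanishingNear U Γ, ContDiffOn ℝ 1 f U := fun f hf => hf.1
  obtain ⟨x, hxΓ, hxpos⟩ := exists_mem_forall_mem_nhdsWithin_pos_measure hpos
  obtain ⟨e, γ, K, V, he, hγ, hV, hxV, hVU⟩ := hUL x (hΓU hxΓ)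
  obtain ⟨r, hr, hrV⟩ := Metric.isOpen_iff.1 hV x hxV
  -- Points of `S` lie within `h` of `x` and are raised by at most `h`, so they stay in `ball x r`.
  set h := r / 3
  have hh : 0 < h := by positivity
  set S := Γ ∩ closedBall x h
  have hScomp : IsCompact S := (isCompact_closedBall x h).inter_left hΓ
  have hSpos : (Measure.hausdorffMeasure ((N : ℝ) - 1) : Measure (Base N)) S ≠ 0 :=
    (hxpos S (inter_mem self_mem_nhdsWithin
      (mem_nhdsWithin_of_mem_nhds (closedBall_mem_nhds x hh)))).ne'
  have hSV : ∀ z ∈ S, z ∈ V := fun z hz =>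
    hrV (closedBall_subset_ball (by simp only [h]; linarith) hz.2)
  have hSγ : ∀ z ∈ S, γ (z - inner ℝ e z • e) = inner ℝ e z := fun z hz =>
    eq_inner_of_mem_frontier hU hγ hV hVU (hSV z hz) (hΓU hz.1)
  have hup : ∀ z ∈ S, ∀ t ∈ Ioc 0 h, z + t • e ∈ U := by
    intro z hz t ht
    have hzV : z + t • e ∈ V := by
      apply hrV
      have hz2 : ‖z - x‖ ≤ h := by simpa [dist_eq_norm] using hz.2
      rw [mem_ball, dist_eq_norm]
      calc ‖z + t • e - x‖ = ‖(z - x) + t • e‖ := by congr 1; abel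
        _ ≤ ‖z - x‖ + ‖t • e‖ := norm_add_le _ _
        _ < r := by
          rw [norm_smul, he, Real.norm_of_nonneg ht.1.le]
          have := ht.2
          simp only [h] at *
          linarith
    rw [hVU _ hzV, sub_inner_add_smul_self he, inner_add_smul_self he, hSγ z hz]
    linarith [ht.1]
  set D := (fun z : Base N × ℝ => z.1 + z.2 • e) '' S ×ˢ Icc (h / 2) h
  have hDm : MeasurableSet D :=
    ((hScomp.prod isCompact_Icc).image (by fun_prop)).isClosed.measurableSet
  have hDU : D ⊆ U := by
    rintro _ ⟨⟨z, t⟩, ⟨hz, ht⟩, rfl⟩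
    exact hup z hz t ⟨(half_pos hh).trans_le ht.1, ht.2⟩
  refine PoincareOn.of_pos_measure hU hUc hUb (hUL.hasInwardTranslations hU) hF hq (S := D)
    ?_ hDm ?_
  · have hq0 : 0 < q := by linarith
    refine ⟨2 ^ (q - 1) * ‖-(h • e)‖ₑ ^ q, ENNReal.mul_ne_top
      (ENNReal.rpow_ne_top_of_nonneg (by linarith) (by simp))
      (ENNReal.rpow_ne_top_of_nonneg hq0.le enorm_ne_top), fun f hf => ?_⟩
    -- From `z + t • e`, descend towards `z` and stop at a small height `τ > 0` where `f` already
    -- vanishes: the whole segment is in `U` and no boundary value of `f` is needed. The step `-(h •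
    -- e)` turns the descent `t - τ` into `a = (t - τ) / h`.
    have hex : ∀ X ∈ D, ∃ a ∈ Icc (0 : ℝ) 1,
        (∀ t ∈ Icc 0 a, X + t • (-(h • e)) ∈ U) ∧ f (X + a • (-(h • e))) = 0 := by
      rintro _ ⟨⟨z, t⟩, ⟨hz, ht⟩, rfl⟩
      dsimp only at hz ht ⊢
      have ht0 : 0 < t := (half_pos hh).trans_le ht.1
      have htend : Tendsto (fun τ : ℝ => z + τ • e) (𝓝[>] 0) (𝓝[U] z) := by
        refine tendsto_nhdsWithin_iff.2 ⟨?_, ?_⟩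
        · have : Continuous fun τ : ℝ => z + τ • e := by fun_prop
          simpa using (this.tendsto 0).mono_left nhdsWithin_le_nhds
        · filter_upwards [Ioc_mem_nhdsGT hh] with τ hτ using hup z hz τ hτ
      obtain ⟨τ, hτf, hτ⟩ := ((htend.eventually (hf.2 z hz.1)).and (Ioc_mem_nhdsGT ht0)).exists
      have hshift : ∀ s : ℝ, z + t • e + s • (-(h • e)) = z + (t - s * h) • e := fun s => by
        rw [smul_neg, smul_smul, sub_smul]; abel
      refine ⟨(t - τ) / h, ⟨div_nonneg (by linarith [hτ.2]) hh.le, ?_⟩, ?_, ?_⟩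
      · rw [div_le_one hh]
        linarith [ht.2, hτ.1]
      · intro s hs
        rw [hshift]
        have h1 : s * h ≤ t - τ := (le_div_iff₀ hh).1 hs.2
        have h2 : 0 ≤ s * h := mul_nonneg hs.1 hh.le
        exact hup z hz _ ⟨by linarith [hτ.1], by linarith [ht.2]⟩
      · rw [hshift, div_mul_cancel₀ _ hh.ne', sub_sub_cancel]
        exact hτf
    choose! a ha haU haf using hex
    have hle := setLIntegral_enorm_rpow_le volume hU (hF f hf) hq hDm (-(h • e)) a ha haU
    have hzero : ∫⁻ X in D, ‖f (X + a X • (-(h • e)))‖ₑ ^ q = 0 := by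
      rw [setLIntegral_congr_fun hDm (g := fun _ => 0) fun X hX => by
        simp only [haf X hX, enorm_zero, ENNReal.zero_rpow_of_pos hq0]]
      simp
    rw [hzero, zero_add, ← mul_assoc] at hle
    exact (lintegral_mono_set inter_subset_left).trans hle
  · rw [inter_eq_left.2 hDU]
    exact volume_sweep_ne_zero he hγ hSγ hSpos (half_lt_self hh)

end LipschitzBoundary

/-! ### Weak and classical gradients, and passage to the limit -/

section WeakGradient

variable {N : ℕ} {U : Set (Ext N)}

lemma _root_.MeasureTheory.LocallyIntegrableOn.integrable_smul_of_tsupport_subset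
    {X E : Type*} [TopologicalSpace X] [T2Space X] [LocallyCompactSpace X] [MeasurableSpace X]
    [BorelSpace X] [SecondCountableTopology X] [NormedAddCommGroup E] [NormedSpace ℝ E]
    {μ : Measure X} {W : Set X} {g : X → E} (hg : LocallyIntegrableOn g W μ) (hW : IsOpen W)
    {ψ : X → ℝ} (hψ : Continuous ψ) (hψc : HasCompactSupport ψ) (hψW : tsupport ψ ⊆ W) :
    Integrable (fun x => ψ x • g x) μ := by
  have h := (hg.continuousOn_smul hW.isLocallyClosed hψ.continuousOn).integrableOn_compact_subset
    hψW hψc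
  refine (integrableOn_iff_integrable_of_support_subset ?_).1 h
  exact (Function.support_smul_subset_left ψ g).trans (subset_tsupport ψ)

/-- The fundamental lemma of the calculus of variations, applied to `g - g'` after pairing with each
fixed vector. -/
lemma IsWeakGradient.ae_eq (hU : IsOpen U) {u : Ext N → ℝ} {g g' : Ext N → ExtVec N}
    (hg : IsWeakGradient U u g) (hg' : IsWeakGradient U u g') :
    g =ᵐ[volume.restrict U] g' := by
  have h := hU.ae_eq_zero_of_integral_contDiff_smul_eq_zero (μ := volume)
    (hg.2.1.sub hg'.2.1) fun ψ hψ hψc hψU => by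
      have hi := hg.2.1.integrable_smul_of_tsupport_subset hU hψ.continuous hψc hψU
      have hi' := hg'.2.1.integrable_smul_of_tsupport_subset hU hψ.continuous hψc hψU
      have hset : ∀ G : Ext N → ExtVec N, ∀ v : Ext N,
          ∫ X in U, inner ℝ (G X) (WithLp.toLp 2 v) * ψ X =
            ∫ X, inner ℝ (WithLp.toLp 2 v) (ψ X • G X) := by
        intro G v
        rw [setIntegral_eq_integral_of_forall_compl_eq_zero]
        · refine integral_congr_ae (Filter.Eventually.of_forall fun X => ?_)
          simp only [inner_smul_right, real_inner_comm, mul_comm]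
        · intro X hX
          rw [image_eq_zero_of_notMem_tsupport fun h => hX (hψU h), mul_zero]
      have heq : ∫ X, ψ X • g X = ∫ X, ψ X • g' X := by
        refine ext_inner_left ℝ fun w => ?_
        rw [← integral_inner hi, ← integral_inner hi']
        have h1 := (hg.2.2 ψ hψ hψc hψU w.ofLp).symm.trans (hg'.2.2 ψ hψ hψc hψU w.ofLp)
        rw [hset, hset, neg_inj] at h1
        exact h1
      simp only [Pi.sub_apply, smul_sub]
      rw [integral_sub hi hi', heq, sub_self]
  rw [Filter.EventuallyEq, ae_restrict_iff' hU.measurableSet]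
  filter_upwards [h] with X hX hXU
  exact sub_eq_zero.1 (hX hXU)

lemma isWeakGradient_weakGrad {u : Ext N → ℝ} (h : ∃ g, IsWeakGradient U u g) :
    IsWeakGradient U u (weakGrad U u) := by
  rw [weakGrad, dif_pos h]
  exact h.choose_spec

lemma IsWeakGradient.sub (hU : IsOpen U) {u u' : Ext N → ℝ} {g g' : Ext N → ExtVec N}
    (hg : IsWeakGradient U u g) (hg' : IsWeakGradient U u' g') :
    IsWeakGradient U (u - u') (g - g') := by
  refine ⟨hg.1.sub hg'.1, hg.2.1.sub hg'.2.1, fun ψ hψ hψc hψU v => ?_⟩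
  have hd : Continuous fun X => fderiv ℝ ψ X v :=
    (hψ.continuous_fderiv (by simp)).clm_apply continuous_const
  have hdc : HasCompactSupport fun X => fderiv ℝ ψ X v := hψc.fderiv_apply ℝ v
  have hdU : tsupport (fun X => fderiv ℝ ψ X v) ⊆ U := (tsupport_fderiv_apply_subset ℝ v).trans hψU
  have hu : ∀ {w : Ext N → ℝ}, LocallyIntegrableOn w U volume →
      IntegrableOn (fun X => w X * fderiv ℝ ψ X v) U := fun hw => by
    simpa only [smul_eq_mul, mul_comm] using
      (hw.integrable_smul_of_tsupport_subset hU hd hdc hdU).integrableOn (s := U)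
  have hv : ∀ {G : Ext N → ExtVec N}, LocallyIntegrableOn G U volume →
      IntegrableOn (fun X => inner ℝ (G X) (WithLp.toLp 2 v) * ψ X) U := fun {G} hG => by
    have h1 := (hG.integrable_smul_of_tsupport_subset hU hψ.continuous hψc hψU).inner_const
      (𝕜 := ℝ) (WithLp.toLp 2 v)
    simpa only [inner_smul_left, mul_comm, conj_trivial] using h1.integrableOn (s := U)
  simp only [Pi.sub_apply, sub_mul, inner_sub_left]
  rw [integral_sub (hu hg.1) (hu hg'.1), integral_sub (hv hg.2.1) (hv hg'.2.1),
    hg.2.2 ψ hψ hψc hψU v, hg'.2.2 ψ hψ hψc hψU v]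
  ring

/-- The classical gradient. -/
noncomputable def classicalGrad (f : Ext N → ℝ) (X : Ext N) : ExtVec N :=
  (InnerProductSpace.toDual ℝ (ExtVec N)).symm
    ((fderiv ℝ f X).comp (WithLp.prodContinuousLinearEquiv 2 ℝ (Base N) ℝ).toContinuousLinearMap)

lemma inner_classicalGrad (f : Ext N → ℝ) (X v : Ext N) :
    inner ℝ (classicalGrad f X) (WithLp.toLp 2 v) = fderiv ℝ f X v := by
  simp [classicalGrad, InnerProductSpace.toDual_symm_apply]

lemma continuous_gradOfDeriv : Continuous fun L : Ext N →L[ℝ] ℝ =>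
    (InnerProductSpace.toDual ℝ (ExtVec N)).symm
      (L.comp (WithLp.prodContinuousLinearEquiv 2 ℝ (Base N) ℝ).toContinuousLinearMap) :=
  (InnerProductSpace.toDual ℝ (ExtVec N)).symm.continuous.comp (continuous_id.clm_comp_const _)

lemma measurable_classicalGrad (f : Ext N → ℝ) : Measurable (classicalGrad f) :=
  continuous_gradOfDeriv.measurable.comp (measurable_fderiv ℝ f)

lemma isWeakGradient_classicalGrad (hU : IsOpen U) {f : Ext N → ℝ} (hf : ContDiffOn ℝ 1 f U) :
    IsWeakGradient U f (classicalGrad f) := by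
  have hfd : ContinuousOn (fderiv ℝ f) U := hf.continuousOn_fderiv_of_isOpen hU le_rfl
  have hfl : LocallyIntegrableOn f U volume :=
    hf.continuousOn.locallyIntegrableOn hU.measurableSet
  refine ⟨hfl, (continuous_gradOfDeriv.comp_continuousOn hfd).locallyIntegrableOn
    hU.measurableSet, fun ψ hψ hψc hψU v => ?_⟩
  have hd : Continuous fun X => fderiv ℝ ψ X v :=
    (hψ.continuous_fderiv (by simp)).clm_apply continuous_const
  have hdU : tsupport (fun X => fderiv ℝ ψ X v) ⊆ U := (tsupport_fderiv_apply_subset ℝ v).trans hψU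
  simp only [inner_classicalGrad]
  rw [setIntegral_eq_integral_of_forall_compl_eq_zero,
    setIntegral_eq_integral_of_forall_compl_eq_zero]
  · have : (volume : Measure (Ext N)).IsAddHaarMeasure :=
      Measure.prod.instIsAddHaarMeasure (volume : Measure (Base N)) (volume : Measure ℝ)
    refine integral_bilinear_hasFDerivAt_right_eq_neg_left_of_integrable
      (B := ContinuousLinearMap.mul ℝ ℝ) (f := f) (f' := fderiv ℝ f) (g := ψ) (g' := fderiv ℝ ψ)
      ?_ ?_ ?_ (fun X hX => ?_) fun X _ => ?_
    · have h1 : LocallyIntegrableOn (fun X => fderiv ℝ f X v) U volume :=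
        (hfd.clm_apply continuousOn_const).locallyIntegrableOn hU.measurableSet
      simpa only [smul_eq_mul, mul_comm, ContinuousLinearMap.mul_apply'] using
        h1.integrable_smul_of_tsupport_subset hU hψ.continuous hψc hψU
    · simpa only [smul_eq_mul, mul_comm, ContinuousLinearMap.mul_apply'] using
        hfl.integrable_smul_of_tsupport_subset hU hd (hψc.fderiv_apply ℝ v) hdU
    · simpa only [smul_eq_mul, mul_comm, ContinuousLinearMap.mul_apply'] using
        hfl.integrable_smul_of_tsupport_subset hU hψ.continuous hψc hψU
    · exact ((hf.differentiableOn one_ne_zero).differentiableAt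
        (hU.mem_nhds (hψU hX))).hasFDerivAt
    · exact (hψ.differentiable (by simp) X).hasFDerivAt
  · intro X hX
    rw [image_eq_zero_of_notMem_tsupport fun h => hX (hψU h), mul_zero]
  · intro X hX
    rw [image_eq_zero_of_notMem_tsupport (f := fun X => fderiv ℝ ψ X v) fun h => hX (hdU h),
      mul_zero]

lemma weightedMeasure_absolutelyContinuous (U : Set (Ext N)) (ρ : Ext N → ℝ) :
    weightedMeasure U ρ ≪ volume.restrict U := withDensity_absolutelyContinuous _ _

lemma weakGrad_ae_eq_classicalGrad (hU : IsOpen U) {f : Ext N → ℝ} (hf : ContDiffOn ℝ 1 f U) :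
    weakGrad U f =ᵐ[volume.restrict U] classicalGrad f :=
  (isWeakGradient_weakGrad ⟨_, isWeakGradient_classicalGrad hU hf⟩).ae_eq hU
    (isWeakGradient_classicalGrad hU hf)

lemma weakGrad_sub_ae_eq (hU : IsOpen U) {u u' : Ext N → ℝ} (h : ∃ g, IsWeakGradient U u g)
    (h' : ∃ g, IsWeakGradient U u' g) :
    weakGrad U (u - u') =ᵐ[volume.restrict U] weakGrad U u - weakGrad U u' := by
  have hsub := (isWeakGradient_weakGrad h).sub hU (isWeakGradient_weakGrad h')
  exact (isWeakGradient_weakGrad ⟨_, hsub⟩).ae_eq hU hsub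

lemma eLpNorm_le_sobolevNorm {ρ : Ext N → ℝ} {p : ℝ≥0∞} (hp : 0 < p.toReal) (u : Ext N → ℝ) :
    eLpNorm u p (weightedMeasure U ρ) ≤ sobolevNorm U ρ p u ∧
      eLpNorm (weakGrad U u) p (weightedMeasure U ρ) ≤ sobolevNorm U ρ p u := by
  simp only [sobolevNorm, one_div]
  exact ⟨(ENNReal.le_rpow_inv_iff hp).2 le_self_add, (ENNReal.le_rpow_inv_iff hp).2 le_add_self⟩

/-- An inequality between `u` and its weak gradient passes to limits in the Sobolev norm. -/
lemma eLpNorm_le_mul_weakGrad_of_approx (hU : IsOpen U) {ρ : Ext N → ℝ} {p : ℝ≥0∞}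
    (hp : 1 ≤ p) (hp' : p ≠ ⊤) {C : ℝ≥0∞} (hC : C ≠ ⊤) {S : Set (Ext N → ℝ)}
    (hS : ∀ φ ∈ S, eLpNorm φ p (weightedMeasure U ρ) ≤
      C * eLpNorm (weakGrad U φ) p (weightedMeasure U ρ))
    {u : Ext N → ℝ} (hu : MemSobolev U ρ p u)
    (happ : ∀ ε : ℝ≥0∞, 0 < ε → ∃ φ ∈ S, MemSobolev U ρ p φ ∧ sobolevNorm U ρ p (u - φ) < ε) :
    eLpNorm u p (weightedMeasure U ρ) ≤ C * eLpNorm (weakGrad U u) p (weightedMeasure U ρ) := by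
  have hp0 : 0 < p.toReal := ENNReal.toReal_pos (by positivity) hp'
  have hac := weightedMeasure_absolutelyContinuous U ρ
  set μ := weightedMeasure U ρ
  -- One `ε` comes from replacing `u` by `φ`, and `C * ε` from replacing the gradient of `φ` by that
  -- of `u`.
  have hstep : ∀ ε : ℝ≥0∞, 0 < ε →
      eLpNorm u p μ ≤ C * eLpNorm (weakGrad U u) p μ + (1 + C) * ε := by
    intro ε hε
    obtain ⟨φ, hφS, hφ, hlt⟩ := happ ε hε
    obtain ⟨h1, h2⟩ := eLpNorm_le_sobolevNorm (U := U) (ρ := ρ) hp0 (u - φ)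
    have h3 : eLpNorm u p μ ≤ eLpNorm (u - φ) p μ + eLpNorm φ p μ := by
      have := eLpNorm_add_le (hu.1.1.sub hφ.1.1) hφ.1.1 hp
      rwa [sub_add_cancel] at this
    have h4 : eLpNorm (weakGrad U φ) p μ ≤
        eLpNorm (weakGrad U u) p μ + eLpNorm (weakGrad U (u - φ)) p μ := by
      rw [eLpNorm_congr_ae (hac.ae_eq (weakGrad_sub_ae_eq hU hu.2.1 hφ.2.1))]
      have := eLpNorm_sub_le hu.2.2.1 (hu.2.2.1.sub hφ.2.2.1) hp
      rwa [sub_sub_cancel] at this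
    calc eLpNorm u p μ ≤ ε + C * (eLpNorm (weakGrad U u) p μ + ε) := by
          refine h3.trans (add_le_add (h1.trans hlt.le) ((hS φ hφS).trans ?_))
          gcongr
          exact h4.trans (by gcongr; exact h2.trans hlt.le)
      _ = _ := by ring
  have hlim : Filter.Tendsto
      (fun ε : ℝ≥0∞ => C * eLpNorm (weakGrad U u) p μ + (1 + C) * ε) (nhdsWithin 0 (Ioi 0))
      (nhds (C * eLpNorm (weakGrad U u) p μ + (1 + C) * 0)) := by
    refine Filter.Tendsto.mono_left ?_ nhdsWithin_le_nhds
    exact tendsto_const_nhds.add (ENNReal.Tendsto.const_mul Filter.tendsto_id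
      (Or.inr (ENNReal.add_ne_top.2 ⟨by simp, hC⟩)))
  rw [mul_zero, add_zero] at hlim
  exact ge_of_tendsto hlim (Filter.eventually_of_mem self_mem_nhdsWithin hstep)

end WeakGradient

/-! ### Slicing the cylinder -/

section Cylinder

open Filter Topology

variable {N M : ℕ}

lemma isOpen_cylinder {Ω : Set (Base N)} (hΩ : IsOpen Ω) : IsOpen (cylinder Ω) :=
  hΩ.prod isOpen_Ioi

lemma cylinder_mono {U Ω : Set (Base N)} (h : U ⊆ Ω) : cylinder U ⊆ cylinder Ω :=
  prod_mono h subset_rfl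

lemma IsCapSmooth.contDiffOn {Ω : Set (Base N)} {φ : Ext N → ℝ} (h : IsCapSmooth Ω φ) :
    ContDiffOn ℝ 1 φ (cylinder Ω) :=
  (h.1.mono subset_closure).of_le (by simp)

/-- For `z ∈ frontier Ω` the point `(z, y)` is on the lateral boundary, hence has a neighbourhood
missing the closed support. -/
lemma IsCapSmooth.slice_mem_vanishingNear {Ω U : Set (Base N)} {φ : Ext N → ℝ}
    (h : IsCapSmooth Ω φ) (hU : U ⊆ Ω) {y : ℝ} (hy : 0 < y) :
    (fun x => φ (x, y)) ∈ vanishingNear U (frontier U ∩ frontier Ω) := by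
  have hmem : ∀ x ∈ U, (x, y) ∈ cylinder Ω := fun x hx => ⟨hU hx, hy⟩
  refine ⟨h.contDiffOn.comp (contDiff_prodMk_left y).contDiffOn hmem, fun z hz => ?_⟩
  have hnot : (z, y) ∉ closure (Function.support φ ∩ closure (cylinder Ω)) := fun hcl =>
    h.2.le_bot ⟨hcl, hz.2, hy.le⟩
  have hcont : Continuous fun x : Base N => (x, y) := by fun_prop
  have hev := hcont.continuousAt.eventually (isClosed_closure.isOpen_compl.mem_nhds hnot)
  filter_upwards [hev.filter_mono nhdsWithin_le_nhds, self_mem_nhdsWithin] with x hx hxU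
  by_contra hne
  exact hx (subset_closure ⟨hne, subset_closure (hmem x hxU)⟩)

/-- `Ext N` carries the sup norm, so the Euclidean gradient is used: it is paired with horizontal
vectors `(v, 0)`, of Euclidean norm `‖v‖`. -/
lemma enorm_fderiv_slice_le {φ : Ext N → ℝ} {x : Base N} {y : ℝ}
    (h : DifferentiableAt ℝ φ (x, y)) :
    ‖fderiv ℝ (fun z => φ (z, y)) x‖ₑ ≤ ‖classicalGrad φ (x, y)‖ₑ := by
  have hd : HasFDerivAt (fun z => φ (z, y)) ((fderiv ℝ φ (x, y)).comp
      (ContinuousLinearMap.inl ℝ (Base N) ℝ)) x :=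
    h.hasFDerivAt.comp x (hasFDerivAt_prodMk_left x y)
  rw [hd.fderiv, enorm_le_iff_norm_le]
  refine ContinuousLinearMap.opNorm_le_bound _ (norm_nonneg _) fun v => ?_
  rw [ContinuousLinearMap.comp_apply, ContinuousLinearMap.inl_apply, ← inner_classicalGrad]
  refine (norm_inner_le_norm _ _).trans_eq ?_
  rw [WithLp.norm_toLp_fst]

lemma lintegral_weightedMeasure {U : Set (Ext N)} {ρ : Ext N → ℝ} (hρ : Measurable ρ)
    (f : Ext N → ℝ≥0∞) :
    ∫⁻ X, f X ∂(weightedMeasure U ρ) = ∫⁻ X in U, ENNReal.ofReal (ρ X) * f X :=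
  lintegral_withDensity_eq_lintegral_mul_non_measurable₀ _ hρ.ennreal_ofReal.aemeasurable
    (Eventually.of_forall fun _ => ENNReal.ofReal_lt_top) f

lemma setLIntegral_cylinder (U : Set (Base N)) {f : Ext N → ℝ≥0∞}
    (hf : AEMeasurable f (volume.restrict (cylinder U))) :
    ∫⁻ X in cylinder U, f X = ∫⁻ y in Ioi (0 : ℝ), ∫⁻ x in U, f (x, y) := by
  rw [cylinder, Measure.volume_eq_prod, ← Measure.prod_restrict] at hf ⊢
  exact lintegral_prod_symm _ hf

lemma stepFun_apply {P : Fin M → Set (Base N)}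
    (hP : Pairwise fun i j => Disjoint (P i) (P j)) (σ : Fin M → ℝ) {i : Fin M} {x : Base N}
    (hx : x ∈ P i) : stepFun P σ x = σ i := by
  rw [stepFun, Finset.sum_eq_single i]
  · exact indicator_of_mem hx _
  · intro j _ hji
    exact indicator_of_notMem (fun hj => (hP hji).le_bot ⟨hj, hx⟩) _
  · simp

lemma measurable_stepWeight (Ω : Set (Base N)) {P : Fin M → Set (Base N)}
    (hP : ∀ i, IsOpen (P i)) (σ : Fin M → ℝ) : Measurable (stepWeight Ω P σ) := by
  have h : Measurable (stepFun P σ) :=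
    Finset.measurable_sum _ fun i _ => measurable_const.indicator (hP i).measurableSet
  have h1 : Measurable fun X : Ext N => X.2 ^ (1 - 2 * stepFun P σ X.1) :=
    measurable_snd.pow (measurable_const.sub ((h.comp measurable_fst).const_mul 2))
  exact h1.const_mul _

/-- Poincaré's inequality on slices, integrated over a cylinder against a weight which depends on
the vertical variable only. -/
lemma IsCapSmooth.setLIntegral_cylinder_le {Ω U : Set (Base N)} (hU : IsOpen U) (hUΩ : U ⊆ Ω)
    (hΩ : IsOpen Ω) {φ : Ext N → ℝ} (hφ : IsCapSmooth Ω φ) {q : ℝ} {C : ℝ≥0∞}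
    (hC : ∀ f ∈ vanishingNear U (frontier U ∩ frontier Ω),
      ∫⁻ x in U ∩ U, ‖f x‖ₑ ^ q ≤ C * ∫⁻ x in U, ‖fderiv ℝ f x‖ₑ ^ q) (hCtop : C ≠ ⊤)
    (hq : 0 ≤ q) {ρ : Ext N → ℝ} (hρ : Measurable ρ) {c : ℝ → ℝ}
    (hρc : ∀ x ∈ U, ∀ y, ρ (x, y) = c y) :
    ∫⁻ X in cylinder U, ENNReal.ofReal (ρ X) * ‖φ X‖ₑ ^ q ≤
      C * ∫⁻ X in cylinder U, ENNReal.ofReal (ρ X) * ‖classicalGrad φ X‖ₑ ^ q := by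
  have hcyl := isOpen_cylinder hU
  have hφm : AEMeasurable φ (volume.restrict (cylinder U)) :=
    (hφ.contDiffOn.continuousOn.mono (cylinder_mono hUΩ)).aemeasurable hcyl.measurableSet
  rw [setLIntegral_cylinder U (f := fun X => ENNReal.ofReal (ρ X) * ‖φ X‖ₑ ^ q)
      (hρ.ennreal_ofReal.aemeasurable.mul (hφm.enorm.pow_const q)),
    setLIntegral_cylinder U (f := fun X => ENNReal.ofReal (ρ X) * ‖classicalGrad φ X‖ₑ ^ q)
      (hρ.ennreal_ofReal.mul ((measurable_classicalGrad φ).enorm.pow_const q)).aemeasurable,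
    ← lintegral_const_mul' _ _ hCtop]
  refine setLIntegral_mono' measurableSet_Ioi fun y hy => ?_
  -- On a slice the weight is the constant `c y`, which factors out of both sides.
  have hconst : ∀ g : Base N → ℝ≥0∞, ∫⁻ x in U, ENNReal.ofReal (ρ (x, y)) * g x =
      ENNReal.ofReal (c y) * ∫⁻ x in U, g x := by
    intro g
    rw [← lintegral_const_mul' _ _ ENNReal.ofReal_ne_top]
    exact setLIntegral_congr_fun hU.measurableSet fun x hx => by simp only [hρc x hx y]
  rw [hconst, hconst, mul_left_comm]
  refine mul_le_mul_right ?_ _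
  have h1 := hC _ (hφ.slice_mem_vanishingNear hUΩ hy)
  rw [inter_self] at h1
  refine h1.trans (mul_le_mul_right ?_ _)
  refine setLIntegral_mono' hU.measurableSet fun x hx => ENNReal.rpow_le_rpow ?_ hq
  refine enorm_fderiv_slice_le ?_
  exact (hφ.contDiffOn.differentiableOn one_ne_zero).differentiableAt
    ((isOpen_cylinder hΩ).mem_nhds ⟨hUΩ hx, hy⟩)

lemma setLIntegral_cylinder_le_sum {Ω : Set (Base N)} {P : Fin M → Set (Base N)}
    (hP : ∀ i, IsOpen (P i)) (hcover : Ω ⊆ ⋃ i, closure (P i))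
    (hnull : ∀ i, volume (frontier (P i)) = 0) (f : Ext N → ℝ≥0∞) :
    ∫⁻ X in cylinder Ω, f X ≤ ∑ i, ∫⁻ X in cylinder (P i), f X := by
  have hZ : (volume : Measure (Ext N)) ((⋃ i, frontier (P i)) ×ˢ univ) = 0 := by
    rw [Measure.volume_eq_prod, Measure.prod_prod, measure_iUnion_null hnull, zero_mul]
  have hsub : cylinder Ω ⊆ (⋃ i, cylinder (P i)) ∪ (⋃ i, frontier (P i)) ×ˢ univ := by
    rintro ⟨x, y⟩ ⟨hx, hy⟩
    obtain ⟨i, hi⟩ := mem_iUnion.1 (hcover hx)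
    by_cases hxi : x ∈ P i
    · exact Or.inl (mem_iUnion.2 ⟨i, hxi, hy⟩)
    · exact Or.inr ⟨mem_iUnion.2 ⟨i, by rw [(hP i).frontier_eq]; exact ⟨hi, hxi⟩⟩, mem_univ _⟩
  calc ∫⁻ X in cylinder Ω, f X
      ≤ ∫⁻ X in (⋃ i, cylinder (P i)) ∪ (⋃ i, frontier (P i)) ×ˢ univ, f X :=
        lintegral_mono_set hsub
    _ ≤ (∫⁻ X in ⋃ i, cylinder (P i), f X) + ∫⁻ X in (⋃ i, frontier (P i)) ×ˢ univ, f X :=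
        lintegral_union_le _ _ _
    _ = ∫⁻ X in ⋃ i, cylinder (P i), f X := by
        rw [Measure.restrict_zero_set hZ, lintegral_zero_measure, add_zero]
    _ ≤ ∑' i, ∫⁻ X in cylinder (P i), f X := lintegral_iUnion_le _ _
    _ = _ := tsum_fintype _

end Cylinder

end VarFrac

/-! ### The weighted inequality -/

theorem theorem6p1 (N : ℕ) (hN : 1 ≤ N) (Ω : Set (VarFrac.Base N))
    (hΩne : Ω.Nonempty) (hΩo : IsOpen Ω) (hΩb : Bornology.IsBounded Ω)
    (hΩL : VarFrac.HasLipschitzBoundary Ω)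
    (M : ℕ) (P : Fin M → Set (VarFrac.Base N))
    (hPo : ∀ i, IsOpen (P i)) (hPsub : ∀ i, P i ⊆ Ω)
    (hPcover : ⋃ i, closure (P i) = closure Ω)
    (hPdisj : Pairwise fun i j => Disjoint (P i) (P j))
    (hPconn : ∀ i, IsConnected (P i))
    (hPL : ∀ i, VarFrac.HasLipschitzBoundary (P i))
    (hTouch : ∀ i, 0 < (Measure.hausdorffMeasure ((N : ℝ) - 1) : Measure (VarFrac.Base N))
      (frontier (P i) ∩ frontier Ω))
    (p : ℝ≥0∞) (hp : 2 ≤ p) (hp' : p ≠ ⊤) :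
    ∃ C : ℝ, 0 < C ∧ ∀ σ : Fin M → ℝ, (∀ i, σ i ∈ Ioo (0 : ℝ) 1) →
      ∀ u : VarFrac.Ext N → ℝ, VarFrac.MemH Ω (VarFrac.stepWeight Ω P σ) p u →
        eLpNorm u p
            (VarFrac.weightedMeasure (VarFrac.cylinder Ω) (VarFrac.stepWeight Ω P σ)) ≤
          ENNReal.ofReal C *
            eLpNorm (VarFrac.weakGrad (VarFrac.cylinder Ω) u) p
              (VarFrac.weightedMeasure (VarFrac.cylinder Ω) (VarFrac.stepWeight Ω P σ)) := by
  open VarFrac in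
  have hp1 : 1 ≤ p := le_trans (by norm_num) hp
  have hp0 : p ≠ 0 := (zero_lt_one.trans_le hp1).ne'
  set q := p.toReal
  have hq : 1 ≤ q := by simpa using ENNReal.toReal_mono hp' hp1
  have hq0 : 0 < q := by linarith
  have hpoin : ∀ i, PoincareOn (vanishingNear (P i) (frontier (P i) ∩ frontier Ω)) (P i) q
      volume (P i) := fun i =>
    poincareOn_vanishingNear (hPo i) (hPconn i).isPreconnected (hΩb.subset (hPsub i)) (hPL i)
      (isClosed_frontier.inter isClosed_frontier) inter_subset_left (hTouch i).ne' hq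
  -- The constants are fixed here, before `σ` is introduced.
  choose C hC hCle using hpoin
  have hK : ∑ i, C i ≠ ⊤ := ENNReal.sum_ne_top.2 fun i _ => hC i
  set D : ℝ≥0∞ := (∑ i, C i) ^ (1 / q)
  have hD : D ≠ ⊤ := ENNReal.rpow_ne_top_of_nonneg (by positivity) hK
  -- The added `1` only ensures positivity, since `D` may vanish.
  refine ⟨D.toReal + 1, by positivity, fun σ _ u hu => ?_⟩
  have hcyl : IsOpen (cylinder Ω) := isOpen_cylinder hΩo
  set w := stepWeight Ω P σ
  have hw : Measurable w := measurable_stepWeight Ω hPo σ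
  refine eLpNorm_le_mul_weakGrad_of_approx (S := {φ | IsCapSmooth Ω φ}) hcyl hp1 hp'
    ENNReal.ofReal_ne_top (fun φ hφ => ?_) hu.1 hu.2
  rw [eLpNorm_congr_ae ((weightedMeasure_absolutelyContinuous (cylinder Ω) w).ae_eq
    (weakGrad_ae_eq_classicalGrad hcyl (IsCapSmooth.contDiffOn hφ))),
    eLpNorm_eq_lintegral_rpow_enorm_toReal hp0 hp',
    eLpNorm_eq_lintegral_rpow_enorm_toReal hp0 hp',
    lintegral_weightedMeasure hw, lintegral_weightedMeasure hw]
  have hmain : ∫⁻ X in cylinder Ω, ENNReal.ofReal (w X) * ‖φ X‖ₑ ^ q ≤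
      (∑ i, C i) * ∫⁻ X in cylinder Ω, ENNReal.ofReal (w X) * ‖classicalGrad φ X‖ₑ ^ q := by
    refine (setLIntegral_cylinder_le_sum hPo (hPcover ▸ subset_closure)
      (fun i => (hPL i).volume_frontier (hPo i)) _).trans ?_
    -- Each piece is bounded by `C i` times the gradient integral over the whole cylinder, so the
    -- constants add up.
    rw [Finset.sum_mul]
    refine Finset.sum_le_sum fun i _ => ?_
    refine (IsCapSmooth.setLIntegral_cylinder_le (hPo i) (hPsub i) hΩo hφ (hCle i) (hC i) hq0.le hw
      (c := fun y => meanConst Ω (stepFun P σ) * y ^ (1 - 2 * σ i)) fun x hx y => ?_).trans ?_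
    · simp only [w, stepWeight, extWeight, stepFun_apply hPdisj σ hx]
    · exact mul_le_mul_right (lintegral_mono_set (cylinder_mono (hPsub i))) _
  calc (∫⁻ X in cylinder Ω, ENNReal.ofReal (w X) * ‖φ X‖ₑ ^ q) ^ (1 / q)
      ≤ ((∑ i, C i) * ∫⁻ X in cylinder Ω,
          ENNReal.ofReal (w X) * ‖classicalGrad φ X‖ₑ ^ q) ^ (1 / q) :=
        ENNReal.rpow_le_rpow hmain (by positivity)
    _ = D * (∫⁻ X in cylinder Ω,
          ENNReal.ofReal (w X) * ‖classicalGrad φ X‖ₑ ^ q) ^ (1 / q) :=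
        ENNReal.mul_rpow_of_nonneg _ _ (by positivity)
    _ ≤ _ := by
        refine mul_le_mul_left ?_ _
        rw [← ENNReal.ofReal_toReal hD]
        exact ENNReal.ofReal_le_ofReal (by rw [ENNReal.toReal_ofReal (by positivity)]; linarith)
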